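/- Let $\Delta$ be a finite simplicial complex (with the empty set counted as a face), let $d\ge 0$, and let $R$ be a commutative coefficient ring that is an integral domain (for instance a field or $\mathbb{Z}$). Definitions. $\Delta$ is a $(d-1)$-dimensional \emph{minimal cycle} over $R$ if it is pure of dimension $d-1$ and supports precisely one $(d-1)$-dimensional homology class up to scalars, with support all of $\Delta$; that is, there is a simplicial $(d-1)$-cycle $\zeta$ of $\Delta$ over $R$ whose coefficient at every facet is nonzero and whose class generates the reduced homology module $\widetilde H_{d-1}(\Delta;R)$. For a complex $\Gamma$ of dimension $e-1$, a set $W$ of vertices is \emph{complete} if every two vertices of $W$ form an edge of $\Gamma$; a complete set $W$ is \emph{critical} if $W\setminus\{v\}$ is a face of $\Gamma$ for some $v\in W$; and $\Gamma$ is \emph{banner} if every critical complete set of size at least $e$ is a face of $\Gamma$. The \emph{degree} of a face is the maximal cardinality of a facet containing it. For a complex $\Delta$ of dimension $d-1$, the \emph{banner number} is $$b(\Delta)=\min\{\,b\ge 0:\ \mathrm{lk}_\sigma\Delta\text{ is banner or the boundary of the 2-simplex, for all faces }\sigma\in\Delta\text{ of cardinality } b \text{ and degree } d\,\}.$$ A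 graph is \emph{$k$-connected} if it has at least $k$ vertices and removing any set of fewer than $k$ vertices results in a connected graph (for $k\le 0$ this is no condition). Theorem. Let $\Delta$ be a $(d-1)$-dimensional minimal cycle over $R$, with banner number $b(\Delta)$. Then the underlying graph (1-skeleton) of $\Delta$ is $(2d-b(\Delta)-2)$-connected. -/

import Mathlib

namespace SimpleGraph

/-- A finite graph is `k`-connected if it has at least `k` vertices and deleting any set of fewer
than `k` vertices leaves a connected graph. -/
def IsVertexConnected {W : Type*} [Finite W] (G : SimpleGraph W) (k : ℕ) : Prop :=
  k ≤ Nat.card W ∧ ∀ S : Finset W, S.card < k → (G.induce ((S : Set W)ᶜ)).Connected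

end SimpleGraph

namespace PreAbstractSimplicialComplex

section Combinatorics

variable {V : Type*}

/-- Faces of `Δ`, the empty face included (Mathlib's `faces` lists only the nonempty ones). -/
def IsFace (Δ : PreAbstractSimplicialComplex V) (s : Finset V) : Prop :=
  s = ∅ ∨ s ∈ Δ.faces

/-- The facets: the faces that are maximal under inclusion. -/
def IsFacet (Δ : PreAbstractSimplicialComplex V) (s : Finset V) : Prop :=
  Maximal Δ.IsFace s

/-- The vertex set of `Δ`. -/
abbrev Vertex (Δ : PreAbstractSimplicialComplex V) : Type _ :=
  {v : V // {v} ∈ Δ.faces}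

variable [DecidableEq V]

/-- The underlying graph (1-skeleton) of `Δ`, on the vertex set of `Δ`. -/
def underlyingGraph (Δ : PreAbstractSimplicialComplex V) : SimpleGraph Δ.Vertex where
  Adj u v := u ≠ v ∧ ({u.1, v.1} : Finset V) ∈ Δ.faces
  symm := ⟨fun u v h => ⟨h.1.symm, by rw [Finset.pair_comm]; exact h.2⟩⟩
  loopless := ⟨fun _ h => h.1 rfl⟩

/-- The link of `σ` in `Δ`: all `τ` disjoint from `σ` such that `τ ∪ σ` is a face of `Δ`. -/
def link (Δ : PreAbstractSimplicialComplex V) (σ : Finset V) : PreAbstractSimplicialComplex V where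
  faces := {τ | τ.Nonempty ∧ Disjoint τ σ ∧ τ ∪ σ ∈ Δ.faces}
  isRelLowerSet_faces := by
    rintro τ ⟨hne, hdisj, hmem⟩
    refine ⟨hne, fun ρ hρ hρne => ⟨hρne, Finset.disjoint_of_subset_left hρ hdisj, ?_⟩⟩
    exact (Δ.isRelLowerSet_faces hmem).2 (Finset.union_subset_union_left hρ)
      (hρne.mono Finset.subset_union_left)

/-- A set of vertices is complete if every two of its vertices form an edge. -/
def IsComplete (Δ : PreAbstractSimplicialComplex V) (W : Finset V) : Prop :=
  (∀ v ∈ W, {v} ∈ Δ.faces) ∧ ∀ u ∈ W, ∀ v ∈ W, u ≠ v → ({u, v} : Finset V) ∈ Δ.faces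

/-- A complete set `W` is critical if `W \ {v}` is a face for some `v ∈ W`. -/
def IsCritical (Δ : PreAbstractSimplicialComplex V) (W : Finset V) : Prop :=
  Δ.IsComplete W ∧ ∃ v ∈ W, Δ.IsFace (W.erase v)

/-- `Δ` is the boundary of a 2-simplex: its faces are the proper subsets of a 3-element set. -/
def IsTriangleBoundary (Δ : PreAbstractSimplicialComplex V) : Prop :=
  ∃ T : Finset V, T.card = 3 ∧ ∀ s : Finset V, Δ.IsFace s ↔ s ⊂ T

variable [Fintype V]

open Classical in
/-- The dimension of `Δ` plus one, i.e. the largest cardinality of a face. -/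
noncomputable def rank (Δ : PreAbstractSimplicialComplex V) : ℕ :=
  (Finset.univ.filter fun s => Δ.IsFace s).sup Finset.card

open Classical in
/-- The degree of a face: the largest cardinality of a facet containing it. -/
noncomputable def degree (Δ : PreAbstractSimplicialComplex V) (σ : Finset V) : ℕ :=
  (Finset.univ.filter fun F => Δ.IsFacet F ∧ σ ⊆ F).sup Finset.card

/-- A `(d-1)`-dimensional complex is banner if every critical complete set of at least `d` vertices
is a face. -/
def IsBanner (Δ : PreAbstractSimplicialComplex V) : Prop :=
  ∀ W : Finset V, Δ.IsCritical W → Δ.rank ≤ W.card → Δ.IsFace W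

/-- The banner number of a `(d-1)`-dimensional complex `Δ`: the least `b` such that the link of
every face of cardinality `b` and degree `d` is banner or the boundary of a 2-simplex. -/
noncomputable def bannerNumber (Δ : PreAbstractSimplicialComplex V) : ℕ :=
  sInf {b : ℕ | ∀ σ : Finset V, Δ.IsFace σ → σ.card = b → Δ.degree σ = Δ.rank →
    (Δ.link σ).IsBanner ∨ (Δ.link σ).IsTriangleBoundary}

end Combinatorics

section Homology

variable {V : Type*} [LinearOrder V] [Fintype V] (R : Type*) [CommRing R]

/-- The simplicial boundary map, written on functions on finite sets of vertices; each simplex is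
oriented by the order of `V`. A simplex `s` contributes to its codimension-one face `s \ {v}` with
the sign `(-1) ^ (position of v in s)`. -/
def boundary : (Finset V → R) →ₗ[R] (Finset V → R) where
  toFun c t := ∑ v ∈ tᶜ, (-1) ^ (t.filter (· < v)).card * c (insert v t)
  map_add' c c' := by
    ext t
    simp [mul_add, Finset.sum_add_distrib]
  map_smul' r c := by
    ext t
    simp [Finset.mul_sum, mul_left_comm]

/-- Simplicial chains of `Δ` on the faces of cardinality `k` (dimension `k - 1`). For `k = 0` this is
spanned by the empty face, so the resulting homology is reduced. -/
def chains (Δ : PreAbstractSimplicialComplex V) (k : ℕ) : Submodule R (Finset V → R) where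
  carrier := {c | ∀ s, c s ≠ 0 → Δ.IsFace s ∧ s.card = k}
  zero_mem' := by
    intro s hs
    exact absurd rfl hs
  add_mem' := by
    intro c c' hc hc' s hs
    by_cases h : c s = 0
    · refine hc' s fun h' => hs ?_
      simp [h, h']
    · exact hc s h
  smul_mem' := by
    intro r c hc s hs
    refine hc s fun h => hs ?_
    simp [h]

/-- Simplicial cycles of `Δ` on faces of cardinality `k`. -/
def cycles (Δ : PreAbstractSimplicialComplex V) (k : ℕ) : Submodule R (Finset V → R) :=
  Δ.chains R k ⊓ LinearMap.ker (boundary R)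

/-- Simplicial boundaries of `Δ` on faces of cardinality `k`. -/
def boundaries (Δ : PreAbstractSimplicialComplex V) (k : ℕ) : Submodule R (Finset V → R) :=
  (Δ.chains R (k + 1)).map (boundary R)

/-- Reduced simplicial homology of `Δ` in dimension `k - 1`. -/
abbrev reducedHomology (Δ : PreAbstractSimplicialComplex V) (k : ℕ) : Type _ :=
  Δ.cycles R k ⧸ (Δ.boundaries R k).submoduleOf (Δ.cycles R k)

/-- `Δ` is a `(d-1)`-dimensional minimal cycle over `R`: it is pure of dimension `d - 1`, and there
is a `(d-1)`-cycle `ζ`, nonzero on every facet, whose class generates the `(d-1)`-st homology. -/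
def IsMinimalCycle (Δ : PreAbstractSimplicialComplex V) (d : ℕ) : Prop :=
  (∀ F, Δ.IsFacet F → F.card = d) ∧
  ∃ ζ : Δ.cycles R d,
    (∀ F, Δ.IsFacet F → (ζ : Finset V → R) F ≠ 0) ∧
    Submodule.span R {(Submodule.Quotient.mk ζ : Δ.reducedHomology R d)} = ⊤

end Homology

end PreAbstractSimplicialComplex

/-! Call a cycle on faces of cardinality `k` essential on a vertex set `S` if it bounds nothing in
the subcomplex induced on `S`. The proof shows that a separator carries an essential cycle, and that
essential cycles need many vertices. If `S` separates `A` from the remaining vertices, cut the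
generator `ζ` down to the facets meeting `A`. Its boundary lies on `S`. A filling within `S` would
give a top-dimensional cycle that is nonzero on the `A` side and zero on the other, hence no
multiple of `ζ` (`IsMinimalCycle.exists_essentialCycleOn`). For the count, an essential cycle can be
replaced by one with an essential link at some vertex (`exists_link`). Doing this `b` times, with
`b` the banner number, costs `b` vertices and leads to a link that is banner or a triangle boundary.
In the banner case each further link costs two vertices, the apex and a non-neighbour of it
(`two_mul_le_card`). So with `k = d - 1` the total is at least `b + 2(d - 1 - b) = 2d - b - 2`. -/

namespace PreAbstractSimplicialComplex

/-! ### Faces, links, and the banner condition under links. -/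

section Complexes

variable {V : Type*} {Γ : PreAbstractSimplicialComplex V}

theorem IsFace.mono {s t : Finset V} (ht : Γ.IsFace t) (hst : s ⊆ t) : Γ.IsFace s := by
  rcases s.eq_empty_or_nonempty with rfl | hs
  · exact Or.inl rfl
  · rcases ht with rfl | ht
    · exact Or.inl (Finset.subset_empty.mp hst)
    · exact Or.inr ((Γ.isRelLowerSet_faces ht).2 hst hs)

theorem IsFace.mem_faces {s : Finset V} (h : Γ.IsFace s) (hs : s.Nonempty) : s ∈ Γ.faces :=
  h.resolve_left hs.ne_empty

theorem IsFace.exists_isFacet [Fintype V] {s : Finset V} (h : Γ.IsFace s) :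
    ∃ F, Γ.IsFacet F ∧ s ⊆ F := by
  obtain ⟨F, hsF, hF⟩ := (Set.toFinite {t | Γ.IsFace t}).exists_le_maximal h
  exact ⟨F, hF, hsF⟩

variable [DecidableEq V]

theorem isFace_link_iff {σ τ : Finset V} (hσ : Γ.IsFace σ) :
    (Γ.link σ).IsFace τ ↔ Disjoint τ σ ∧ Γ.IsFace (τ ∪ σ) := by
  constructor
  · rintro (rfl | ⟨-, h, h'⟩)
    · exact ⟨Finset.disjoint_empty_left σ, by simpa using hσ⟩
    · exact ⟨h, Or.inr h'⟩
  · rintro ⟨h, h'⟩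
    rcases τ.eq_empty_or_nonempty with rfl | hτ
    · exact Or.inl rfl
    · exact Or.inr ⟨hτ, h, h'.mem_faces (hτ.mono Finset.subset_union_left)⟩

theorem isFace_link_singleton_iff {v : V} (hv : Γ.IsFace {v}) {τ : Finset V} :
    (Γ.link {v}).IsFace τ ↔ v ∉ τ ∧ Γ.IsFace (insert v τ) := by
  rw [isFace_link_iff hv, Finset.disjoint_singleton_right, Finset.union_comm]
  rfl

theorem link_empty : Γ.link ∅ = Γ := by
  ext τ
  constructor
  · rintro ⟨-, -, h⟩
    simpa using h
  · intro h
    exact ⟨(Γ.isRelLowerSet_faces h).1, Finset.disjoint_empty_right τ, by simpa using h⟩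

theorem link_link_singleton {v : V} {σ : Finset V} (hv : v ∉ σ) :
    (Γ.link {v}).link σ = Γ.link (insert v σ) := by
  ext τ
  have e : τ ∪ σ ∪ {v} = τ ∪ insert v σ := by
    ext x; simp only [Finset.mem_union, Finset.mem_insert, Finset.mem_singleton]; tauto
  constructor
  · rintro ⟨h1, h2, -, h3, h4⟩
    rw [e] at h4
    rw [Finset.disjoint_singleton_right, Finset.mem_union, not_or] at h3
    exact ⟨h1, Finset.disjoint_insert_right.mpr ⟨h3.1, h2⟩, h4⟩
  · rintro ⟨h1, h2, h3⟩
    rw [Finset.disjoint_insert_right] at h2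
    refine ⟨h1, h2.2, h1.mono Finset.subset_union_left, ?_, by rwa [e]⟩
    rw [Finset.disjoint_singleton_right, Finset.mem_union, not_or]
    exact ⟨h2.1, hv⟩

/-- Every critical complete set of more than `k` vertices is a face. -/
def IsBannerAbove (Γ : PreAbstractSimplicialComplex V) (k : ℕ) : Prop :=
  ∀ W : Finset V, Γ.IsCritical W → k < W.card → Γ.IsFace W

/-- Adding `v` to a critical complete set of the link gives a critical complete set of `Γ` with one
more vertex. -/
theorem IsBannerAbove.link_singleton {k : ℕ} (h : Γ.IsBannerAbove (k + 1)) {v : V}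
    (hv : Γ.IsFace {v}) : (Γ.link {v}).IsBannerAbove k := by
  rintro W ⟨⟨hW, hW'⟩, w, hw, hcrit⟩ hk
  have hvW : v ∉ W := fun hvW => by
    have := (hW v hvW).2.1
    simp at this
  have hpair : ∀ x ∈ W, ({v, x} : Finset V) ∈ Γ.faces := fun x hx => by
    rw [Finset.pair_comm]; exact (hW x hx).2.2
  rw [isFace_link_singleton_iff hv] at hcrit ⊢
  have hwv : w ≠ v := fun e => hvW (e ▸ hw)
  refine ⟨hvW, h _ ⟨⟨?_, ?_⟩, w, Finset.mem_insert_of_mem hw, ?_⟩ ?_⟩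
  · intro x hx
    rcases Finset.mem_insert.mp hx with rfl | hx
    · exact hv.mem_faces (Finset.singleton_nonempty _)
    · exact (Γ.isRelLowerSet_faces (hpair x hx)).2 (by simp) (Finset.singleton_nonempty x)
  · intro x hx y hy hxy
    rcases Finset.mem_insert.mp hx with hx | hx <;> rcases Finset.mem_insert.mp hy with hy | hy
    · exact absurd (hx.trans hy.symm) hxy
    · rw [hx]; exact hpair y hy
    · rw [hy, Finset.pair_comm]; exact hpair x hx
    · exact (Γ.isRelLowerSet_faces (hW' x hx y hy hxy).2.2).2 Finset.subset_union_left
        (Finset.insert_nonempty x _)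
  · rw [Finset.erase_insert_of_ne hwv.symm]
    exact hcrit.2
  · rw [Finset.card_insert_of_notMem hvW]
    omega

end Complexes

/-! ### Sign calculus: contraction and coning as anticommuting operators. -/

section Operators

variable {V : Type*} [LinearOrder V] {R : Type*} [CommRing R]

/-- The sign with which `v` is inserted into `t`. -/
def insertSign (R : Type*) [CommRing R] (v : V) (t : Finset V) : R :=
  (-1) ^ (t.filter (· < v)).card

theorem insertSign_mul_self (v : V) (t : Finset V) :
    insertSign R v t * insertSign R v t = 1 := by
  rw [insertSign, ← mul_pow]; simp

theorem insertSign_insert_self (v : V) (t : Finset V) :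
    insertSign R v (insert v t) = insertSign R v t := by
  simp [insertSign, Finset.filter_insert]

theorem insertSign_insert_of_lt {u v : V} {t : Finset V} (h : u < v) (hu : u ∉ t) :
    insertSign R v (insert u t) = -insertSign R v t := by
  rw [insertSign, Finset.filter_insert, if_pos h, Finset.card_insert_of_notMem (by simp [hu]),
    pow_succ, insertSign]
  ring

theorem insertSign_insert_of_gt {u v : V} {t : Finset V} (h : v < u) :
    insertSign R v (insert u t) = insertSign R v t := by
  rw [insertSign, Finset.filter_insert, if_neg h.not_gt, insertSign]

/-- The part of the boundary obtained by removing `v`. -/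
def contract (R : Type*) [CommRing R] (v : V) : (Finset V → R) →ₗ[R] (Finset V → R) where
  toFun c t := if v ∈ t then 0 else insertSign R v t * c (insert v t)
  map_add' c c' := by
    ext t
    by_cases h : v ∈ t <;> simp [h, mul_add]
  map_smul' r c := by
    ext t
    by_cases h : v ∈ t <;> simp [h, mul_left_comm]

/-- The cone over a chain with apex `v`. -/
def cone (R : Type*) [CommRing R] (v : V) : (Finset V → R) →ₗ[R] (Finset V → R) where
  toFun c s := if v ∈ s then insertSign R v s * c (s.erase v) else 0
  map_add' c c' := by
    ext t
    by_cases h : v ∈ t <;> simp [h, mul_add]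
  map_smul' r c := by
    ext t
    by_cases h : v ∈ t <;> simp [h, mul_left_comm]

theorem contract_apply (v : V) (c : Finset V → R) (t : Finset V) :
    contract R v c t = if v ∈ t then 0 else insertSign R v t * c (insert v t) := rfl

theorem cone_apply (v : V) (c : Finset V → R) (s : Finset V) :
    cone R v c s = if v ∈ s then insertSign R v s * c (s.erase v) else 0 := rfl

theorem cone_contract_apply (v : V) (c : Finset V → R) (s : Finset V) :
    cone R v (contract R v c) s = if v ∈ s then c s else 0 := by
  rw [cone_apply]
  split_ifs with h
  · obtain ⟨t, ht, rfl⟩ : ∃ t, v ∉ t ∧ insert v t = s :=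
      ⟨s.erase v, Finset.notMem_erase v s, Finset.insert_erase h⟩
    rw [Finset.erase_insert ht, contract_apply, if_neg ht, insertSign_insert_self, ← mul_assoc,
      insertSign_mul_self, one_mul]
  · rfl

theorem contract_cone_apply (v : V) (c : Finset V → R) (s : Finset V) :
    contract R v (cone R v c) s = if v ∈ s then 0 else c s := by
  rw [contract_apply]
  split_ifs with h
  · rfl
  · rw [cone_apply, if_pos (Finset.mem_insert_self v s), Finset.erase_insert h,
      insertSign_insert_self, ← mul_assoc, insertSign_mul_self, one_mul]

theorem contract_cone_add_cone_contract_self (v : V) (c : Finset V → R) :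
    contract R v (cone R v c) + cone R v (contract R v c) = c := by
  ext s
  rw [Pi.add_apply, contract_cone_apply, cone_contract_apply]
  split_ifs <;> simp

/-- With `contract_cone_add_cone_contract_self` and `contract_contract_add`, these are the
anticommutation relations of interior and exterior multiplication; the boundary is the sum of all
contractions. -/
theorem contract_cone_add_cone_contract {u v : V} (huv : u ≠ v) (c : Finset V → R) :
    contract R u (cone R v c) + cone R v (contract R u c) = 0 := by
  ext s
  rw [Pi.add_apply, contract_apply, cone_apply, cone_apply, contract_apply]
  by_cases hv : v ∈ s
  · obtain ⟨t, ht, rfl⟩ : ∃ t, v ∉ t ∧ insert v t = s :=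
      ⟨s.erase v, Finset.notMem_erase v s, Finset.insert_erase hv⟩
    rw [Finset.erase_insert ht]
    by_cases hu : u ∈ t
    · simp [hu]
    · have hv' : v ∉ insert u t := by simp [huv.symm, ht]
      have hu' : u ∉ insert v t := by simp [huv, hu]
      rw [if_neg hu', if_pos (by simp), if_pos (by simp), if_neg hu, Finset.insert_comm u v t,
        Finset.erase_insert hv', insertSign_insert_self, insertSign_insert_self]
      rcases huv.lt_or_gt with h | h
      · rw [insertSign_insert_of_gt h, insertSign_insert_of_lt h hu, Pi.zero_apply]
        ring
      · rw [insertSign_insert_of_gt h, insertSign_insert_of_lt h ht, Pi.zero_apply]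
        ring
  · simp [hv, huv.symm]

theorem contract_contract_self (v : V) (c : Finset V → R) :
    contract R v (contract R v c) = 0 := by
  ext s
  simp [contract_apply]

theorem contract_contract_add (u v : V) (c : Finset V → R) :
    contract R u (contract R v c) + contract R v (contract R u c) = 0 := by
  rcases eq_or_ne u v with rfl | huv
  · simp [contract_contract_self]
  ext s
  simp only [Pi.add_apply, contract_apply, Pi.zero_apply, Finset.mem_insert, huv, huv.symm,
    false_or]
  by_cases hu : u ∈ s
  · simp [hu]
  by_cases hv : v ∈ s
  · simp [hv]
  rw [if_neg hu, if_neg hv, if_neg hv, if_neg hu, Finset.insert_comm u v s]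
  rcases huv.lt_or_gt with h | h
  · rw [insertSign_insert_of_gt h, insertSign_insert_of_lt h hu]
    ring
  · rw [insertSign_insert_of_gt h, insertSign_insert_of_lt h hv]
    ring

variable [Fintype V]

theorem boundary_apply (c : Finset V → R) (t : Finset V) :
    boundary R c t = ∑ v ∈ tᶜ, insertSign R v t * c (insert v t) := rfl

theorem boundary_eq_sum_contract (c : Finset V → R) :
    boundary R c = ∑ v, contract R v c := by
  ext t
  rw [boundary_apply, Finset.sum_apply, ← Finset.sum_subset (Finset.subset_univ tᶜ)]
  · refine Finset.sum_congr rfl fun v hv => ?_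
    rw [contract_apply, if_neg (Finset.mem_compl.mp hv)]
  · intro v _ hv
    rw [contract_apply, if_pos (by simpa using hv)]

theorem boundary_boundary (c : Finset V → R) : boundary R (boundary R c) = 0 := by
  rw [boundary_eq_sum_contract (boundary R c)]
  simp_rw [boundary_eq_sum_contract c, map_sum]
  rw [← Finset.sum_product']
  -- The terms for `(u, v)` and `(v, u)` cancel, and the diagonal ones vanish; no division by 2 is
  -- needed.
  refine Finset.sum_involution (fun p _ => p.swap) (fun p _ => contract_contract_add _ _ c) ?_
    (fun _ _ => by simp) (fun _ _ => rfl)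
  rintro ⟨u, v⟩ _ hne heq
  obtain rfl : v = u := congrArg Prod.fst heq
  exact hne (contract_contract_self v c)

theorem boundary_contract (v : V) (c : Finset V → R) :
    boundary R (contract R v c) = -contract R v (boundary R c) := by
  rw [eq_neg_iff_add_eq_zero, boundary_eq_sum_contract, boundary_eq_sum_contract c, map_sum,
    ← Finset.sum_add_distrib]
  exact Finset.sum_eq_zero fun u _ => contract_contract_add u v c

/-- The cone is a contracting homotopy: only the contraction at the apex fails to anticommute with
it. -/
theorem boundary_cone (v : V) (c : Finset V → R) :
    boundary R (cone R v c) + cone R v (boundary R c) = c := by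
  rw [boundary_eq_sum_contract, boundary_eq_sum_contract c, map_sum, ← Finset.sum_add_distrib,
    Finset.sum_eq_single v (fun u _ huv => contract_cone_add_cone_contract huv c) (by simp)]
  exact contract_cone_add_cone_contract_self v c

end Operators

/-! ### Essential cycles on induced subcomplexes and their vertex counts. -/

section Chains

variable {V : Type*} {R : Type*} [CommRing R]
  {Γ : PreAbstractSimplicialComplex V} {S T : Finset V} {k : ℕ} {c c' z : Finset V → R}

/-- `c` is a chain on the faces of cardinality `k` of the subcomplex of `Γ` induced on `S`. -/
def IsChainOn (Γ : PreAbstractSimplicialComplex V) (S : Finset V) (k : ℕ)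
    (c : Finset V → R) : Prop :=
  ∀ s, c s ≠ 0 → Γ.IsFace s ∧ s.card = k ∧ s ⊆ S

theorem IsChainOn.mono (h : Γ.IsChainOn S k c) (hST : S ⊆ T) : Γ.IsChainOn T k c :=
  fun s hs => ⟨(h s hs).1, (h s hs).2.1, (h s hs).2.2.trans hST⟩

theorem IsChainOn.add (h : Γ.IsChainOn S k c) (h' : Γ.IsChainOn S k c') :
    Γ.IsChainOn S k (c + c') := by
  intro s hs
  by_cases hc : c s = 0
  · exact h' s fun h0 => hs (by simp [hc, h0])
  · exact h s hc

theorem IsChainOn.neg (h : Γ.IsChainOn S k c) : Γ.IsChainOn S k (-c) :=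
  fun s hs => h s fun h0 => hs (by simp [h0])

theorem IsChainOn.sub (h : Γ.IsChainOn S k c) (h' : Γ.IsChainOn S k c') :
    Γ.IsChainOn S k (c - c') :=
  sub_eq_add_neg c c' ▸ h.add h'.neg

variable [LinearOrder V]

theorem IsChainOn.contract (h : Γ.IsChainOn S (k + 1) c) {v : V} (hv : Γ.IsFace {v}) :
    (Γ.link {v}).IsChainOn (S.erase v) k (contract R v c) := by
  intro s hs
  rw [contract_apply] at hs
  split_ifs at hs with hvs
  · exact absurd rfl hs
  obtain ⟨h1, h2, h3⟩ := h _ (right_ne_zero_of_mul hs)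
  rw [Finset.card_insert_of_notMem hvs] at h2
  exact ⟨(isFace_link_singleton_iff hv).mpr ⟨hvs, h1⟩, by omega,
    Finset.subset_erase.mpr ⟨(Finset.subset_insert v s).trans h3, hvs⟩⟩

theorem IsChainOn.cone {v : V} (h : (Γ.link {v}).IsChainOn (S.erase v) k c) (hvS : v ∈ S)
    (hv : Γ.IsFace {v}) : Γ.IsChainOn S (k + 1) (cone R v c) := by
  intro s hs
  rw [cone_apply] at hs
  split_ifs at hs with hvs
  · obtain ⟨h1, h2, h3⟩ := h _ (right_ne_zero_of_mul hs)
    rw [isFace_link_singleton_iff hv, Finset.insert_erase hvs] at h1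
    refine ⟨h1.2, ?_, ?_⟩
    · rw [← Finset.card_erase_add_one hvs, h2]
    · rw [← Finset.insert_erase hvs]
      exact Finset.insert_subset hvS (h3.trans (Finset.erase_subset v S))
  · exact absurd rfl hs

theorem IsChainOn.of_link {v : V} (h : (Γ.link {v}).IsChainOn S k c) (hv : Γ.IsFace {v}) :
    Γ.IsChainOn S k c := fun s hs =>
  ⟨((isFace_link_singleton_iff hv).mp (h s hs).1).2.mono (Finset.subset_insert v s), (h s hs).2⟩

variable [Fintype V]

/-- `z` is a cycle, but not a boundary, on the faces of cardinality `k` of the subcomplex of `Γ`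
induced on `S`. -/
structure IsEssentialCycleOn (Γ : PreAbstractSimplicialComplex V) (S : Finset V) (k : ℕ)
    (z : Finset V → R) : Prop where
  isChainOn : Γ.IsChainOn S k z
  boundary_eq_zero : boundary R z = 0
  not_boundary : ∀ c, Γ.IsChainOn S (k + 1) c → boundary R c ≠ z

namespace IsEssentialCycleOn

theorem anti (h : Γ.IsEssentialCycleOn T k z) (hST : S ⊆ T) (hz : Γ.IsChainOn S k z) :
    Γ.IsEssentialCycleOn S k z :=
  ⟨hz, h.boundary_eq_zero, fun c hc => h.not_boundary c (hc.mono hST)⟩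

theorem exists_ne_zero (h : Γ.IsEssentialCycleOn S k z) : ∃ s, z s ≠ 0 := by
  by_contra! h0
  exact h.not_boundary 0 (fun s hs => absurd rfl hs) (by rw [map_zero]; exact (funext h0).symm)

theorem le_card (h : Γ.IsEssentialCycleOn S k z) : k ≤ S.card := by
  obtain ⟨s, hs⟩ := h.exists_ne_zero
  obtain ⟨-, rfl, h3⟩ := h.isChainOn s hs
  exact Finset.card_le_card h3

/-- With only `k` vertices the cycle would be a multiple of a single simplex, whose boundary is
nonzero. -/
theorem lt_card (h : Γ.IsEssentialCycleOn S k z) (hk : 0 < k) : k < S.card := by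
  refine h.le_card.lt_of_ne fun hkS => ?_
  have huniq : ∀ s, z s ≠ 0 → s = S := fun s hs =>
    Finset.eq_of_subset_of_card_le (h.isChainOn s hs).2.2 (by rw [(h.isChainOn s hs).2.1, hkS])
  obtain ⟨s, hs⟩ := h.exists_ne_zero
  obtain rfl := huniq s hs
  obtain ⟨v, hv⟩ : s.Nonempty := Finset.card_pos.mp (hkS ▸ hk)
  have hb := congrFun h.boundary_eq_zero (s.erase v)
  rw [boundary_apply, Finset.sum_eq_single v, Finset.insert_erase hv, Pi.zero_apply] at hb
  · apply hs
    rw [← one_mul (z s), ← insertSign_mul_self v (s.erase v), mul_assoc, hb, mul_zero]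
  · intro u hu huv
    by_contra hne
    have := huniq _ (right_ne_zero_of_mul hne)
    have hmem := this ▸ Finset.mem_insert_self u (s.erase v)
    simp [huv, hmem] at hu
  · simp

/-- After shrinking `S`, an essential cycle has an essential link at some vertex. -/
theorem exists_link (h : Γ.IsEssentialCycleOn S (k + 1) z) :
    ∃ T ⊆ S, ∃ v ∈ T, ∃ y : Finset V → R, Γ.IsFace {v} ∧ Γ.IsEssentialCycleOn T (k + 1) y ∧
      (Γ.link {v}).IsEssentialCycleOn (T.erase v) k (contract R v y) := by
  induction S using Finset.strongInduction generalizing z with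
  | H S ih =>
    obtain ⟨F, hF⟩ := h.exists_ne_zero
    obtain ⟨hFf, hFc, hFS⟩ := h.isChainOn F hF
    obtain ⟨v, hvF⟩ : F.Nonempty := Finset.card_pos.mp (by omega)
    have hv : Γ.IsFace {v} := hFf.mono (Finset.singleton_subset_iff.mpr hvF)
    have hvS := hFS hvF
    by_cases hl : (Γ.link {v}).IsEssentialCycleOn (S.erase v) k (contract R v z)
    · exact ⟨S, subset_rfl, v, hvS, z, hv, h, hl⟩
    -- Otherwise the link cycle bounds some `c` in the link. Adding the boundary of the cone over
    -- `c` replaces the star part of `z` at `v` by `c`, so the homologous cycle avoids `v` and `S`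
    -- shrinks.
    obtain ⟨c, hc, hcz⟩ : ∃ c, (Γ.link {v}).IsChainOn (S.erase v) (k + 1) c ∧
        boundary R c = contract R v z := by
      by_contra! hne
      refine hl ⟨h.isChainOn.contract hv, ?_, hne⟩
      rw [boundary_contract, h.boundary_eq_zero, map_zero, neg_zero]
    have hcone := hc.cone hvS hv
    have hbc : boundary R (cone R v c) = c - cone R v (contract R v z) := by
      rw [eq_sub_iff_add_eq, ← hcz]
      exact boundary_cone v c
    have hy : Γ.IsEssentialCycleOn (S.erase v) (k + 1) (z + boundary R (cone R v c)) := by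
      refine ⟨?_, ?_, ?_⟩
      · rw [hbc, add_sub_left_comm]
        refine (hc.of_link hv).add fun s hs => ?_
        rw [Pi.sub_apply, cone_contract_apply] at hs
        split_ifs at hs with hvs
        · exact absurd (sub_self _) hs
        · obtain ⟨h1, h2, h3⟩ := h.isChainOn s (by simpa using hs)
          exact ⟨h1, h2, Finset.subset_erase.mpr ⟨h3, hvs⟩⟩
      · rw [map_add, h.boundary_eq_zero, boundary_boundary, add_zero]
      · intro w hw hwz
        refine h.not_boundary _ ((hw.mono (Finset.erase_subset v S)).sub hcone) ?_
        rw [map_sub, hwz, add_sub_cancel_right]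
    obtain ⟨T, hT, rest⟩ := ih _ (Finset.erase_ssubset hvS) hy
    exact ⟨T, hT.trans (Finset.erase_subset v S), rest⟩

theorem two_mul_le_card (h : Γ.IsEssentialCycleOn S k z) (hΓ : Γ.IsBannerAbove k) :
    2 * k ≤ S.card := by
  induction k generalizing Γ S z with
  | zero => simp
  | succ k ih =>
    obtain ⟨T, hTS, v, hvT, y, hv, hy, hl⟩ := h.exists_link
    -- If `v` were adjacent to all of `T`, each simplex of the cone over `y` would be critical and
    -- complete, with `k + 2` vertices, hence a face; then `y` would bound its cone.
    obtain ⟨u, huT, huv, hu⟩ : ∃ u ∈ T, u ≠ v ∧ ({v, u} : Finset V) ∉ Γ.faces := by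
      by_contra! hadj
      refine hy.not_boundary (cone R v y) ?_ ?_
      · intro s hs
        rw [cone_apply] at hs
        split_ifs at hs with hvs
        swap
        · exact absurd rfl hs
        obtain ⟨h1, h2, h3⟩ := hy.isChainOn _ (right_ne_zero_of_mul hs)
        have hcard : s.card = k + 1 + 1 := by rw [← Finset.card_erase_add_one hvs, h2]
        have hsT : s ⊆ T := by
          rw [← Finset.insert_erase hvs]
          exact Finset.insert_subset hvT h3
        refine ⟨hΓ s ⟨⟨?_, ?_⟩, v, hvs, h1⟩ (by omega), hcard, hsT⟩
        · intro x hx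
          rcases eq_or_ne x v with rfl | hxv
          · exact hv.mem_faces (Finset.singleton_nonempty _)
          · exact (Γ.isRelLowerSet_faces (hadj x (hsT hx) hxv)).2 (by simp)
              (Finset.singleton_nonempty x)
        · intro x hx x' hx' hne
          rcases eq_or_ne x v with rfl | hxv
          · exact hadj x' (hsT hx') hne.symm
          rcases eq_or_ne x' v with rfl | hxv'
          · rw [Finset.pair_comm]
            exact hadj x (hsT hx) hne
          · refine (h1.mono ?_).mem_faces (Finset.insert_nonempty x _)
            simp [Finset.insert_subset_iff, hx, hx', hxv, hxv']
      · have := boundary_cone v y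
        rwa [hy.boundary_eq_zero, map_zero, add_zero] at this
    -- A non-neighbour `u` of `v` lies in no face of the link, so the link cycle lives on `T`
    -- without `u` and `v`.
    have hl' := hl.anti (Finset.erase_subset u (T.erase v)) fun s hs => by
      obtain ⟨h1, h2, h3⟩ := hl.isChainOn s hs
      refine ⟨h1, h2, Finset.subset_erase.mpr ⟨h3, fun hus => hu ?_⟩⟩
      exact (((isFace_link_singleton_iff hv).mp h1).2.mono
        (Finset.insert_subset_insert v (Finset.singleton_subset_iff.mpr hus))).mem_faces
        (Finset.insert_nonempty v _)
    have hcard := ih hl' (hΓ.link_singleton hv)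
    rw [Finset.card_erase_of_mem (by simp [huT, huv]), Finset.card_erase_of_mem hvT] at hcard
    have h2 : 2 ≤ T.card := by
      rw [← Finset.card_pair huv]
      exact Finset.card_le_card (by simp [Finset.insert_subset_iff, huT, hvT])
    have := Finset.card_le_card hTS
    omega

theorem exists_link_of_card {b : ℕ} (h : Γ.IsEssentialCycleOn S (k + b) z) :
    ∃ σ T : Finset V, ∃ y : Finset V → R, Γ.IsFace σ ∧ σ.card = b ∧ T.card + b ≤ S.card ∧
      (Γ.link σ).IsEssentialCycleOn T k y := by
  induction b generalizing Γ S z with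
  | zero => exact ⟨∅, S, z, Or.inl rfl, rfl, le_rfl, by rwa [link_empty]⟩
  | succ b ih =>
    obtain ⟨T, hTS, v, hvT, y, hv, hy, hl⟩ := h.exists_link (k := k + b)
    obtain ⟨σ, T', y', hσ, hσb, hT', hy'⟩ := ih hl
    rw [isFace_link_singleton_iff hv] at hσ
    rw [link_link_singleton hσ.1] at hy'
    refine ⟨_, T', y', hσ.2, by rw [Finset.card_insert_of_notMem hσ.1, hσb], ?_, hy'⟩
    have := Finset.card_le_card hTS
    have := Finset.card_erase_add_one hvT
    omega

end IsEssentialCycleOn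

end Chains

/-! ### Rank, degree and banner number of pure complexes. -/

section Pure

variable {V : Type*} [Fintype V] {Δ : PreAbstractSimplicialComplex V} {d : ℕ}

theorem card_le_of_pure (h : ∀ F, Δ.IsFacet F → F.card = d) {s : Finset V} (hs : Δ.IsFace s) :
    s.card ≤ d := by
  obtain ⟨F, hF, hsF⟩ := hs.exists_isFacet
  exact h F hF ▸ Finset.card_le_card hsF

theorem card_le_rank {s : Finset V} (hs : Δ.IsFace s) : s.card ≤ Δ.rank := by
  classical
  exact Finset.le_sup (f := Finset.card) (by simpa using hs)

theorem rank_le {n : ℕ} (h : ∀ s, Δ.IsFace s → s.card ≤ n) : Δ.rank ≤ n := by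
  classical
  exact Finset.sup_le fun s hs => h s (by simpa using hs)

theorem rank_eq_of_pure (h : ∀ F, Δ.IsFacet F → F.card = d) : Δ.rank = d := by
  obtain ⟨F, hF, -⟩ := (show Δ.IsFace ∅ from Or.inl rfl).exists_isFacet
  exact le_antisymm (rank_le fun s hs => card_le_of_pure h hs) (h F hF ▸ card_le_rank hF.1)

variable [DecidableEq V]

theorem degree_eq_of_pure (h : ∀ F, Δ.IsFacet F → F.card = d) {σ : Finset V} (hσ : Δ.IsFace σ) :
    Δ.degree σ = d := by
  classical
  obtain ⟨F, hF, hσF⟩ := hσ.exists_isFacet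
  refine le_antisymm (Finset.sup_le fun G hG => ?_) ?_
  · exact (h G (Finset.mem_filter.mp hG).2.1).le
  · rw [← h F hF]
    exact Finset.le_sup (f := Finset.card) (by simpa using ⟨hF, hσF⟩)

theorem link_isBanner_or_isTriangleBoundary (h : ∀ F, Δ.IsFacet F → F.card = d) {σ : Finset V}
    (hσ : Δ.IsFace σ) (hb : σ.card = Δ.bannerNumber) :
    (Δ.link σ).IsBanner ∨ (Δ.link σ).IsTriangleBoundary := by
  have hmem := Nat.sInf_mem (s := {b : ℕ | ∀ σ : Finset V, Δ.IsFace σ → σ.card = b →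
    Δ.degree σ = Δ.rank → (Δ.link σ).IsBanner ∨ (Δ.link σ).IsTriangleBoundary})
    -- No face has `d + 1` vertices, so `d + 1` satisfies the condition vacuously and the infimum is
    -- attained.
    ⟨d + 1, fun τ hτ hcard => by
      have := card_le_of_pure h hτ
      omega⟩
  exact hmem σ hσ hb (by rw [degree_eq_of_pure h hσ, rank_eq_of_pure h])

end Pure

/-! ### Minimal cycles, separators and the final count. -/

section MinimalCycle

variable {V : Type*} [Fintype V] [LinearOrder V] {R : Type*} [CommRing R]
  {Δ : PreAbstractSimplicialComplex V} {d : ℕ}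

/-- Needed for `k = d - 1` on a separator and for `k = d` on the whole vertex set. -/
theorem IsEssentialCycleOn.two_mul_sub_bannerNumber_le_card
    (h : ∀ F, Δ.IsFacet F → F.card = d) {S : Finset V} {k : ℕ} {z : Finset V → R}
    (hz : Δ.IsEssentialCycleOn S k z) (hk : d ≤ k + 1) :
    2 * d - Δ.bannerNumber - 2 ≤ S.card := by
  rcases lt_or_ge k Δ.bannerNumber with hb | hb
  · have := hz.le_card
    omega
  obtain ⟨m, rfl⟩ := Nat.exists_eq_add_of_le' hb
  obtain ⟨σ, T, y, hσ, hσb, hTS, hy⟩ := hz.exists_link_of_card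
  rcases link_isBanner_or_isTriangleBoundary h hσ hσb with hban | ⟨P, hP, hlink⟩
  · have hrank : (Δ.link σ).rank ≤ m + 1 := rank_le fun τ hτ => by
      rw [isFace_link_iff hσ] at hτ
      have := card_le_of_pure h hτ.2
      rw [Finset.card_union_of_disjoint hτ.1] at this
      omega
    have := hy.two_mul_le_card fun W hW hmW => hban W hW (by omega)
    omega
  -- In a triangle boundary faces have at most two vertices, so `d` exceeds the banner number by at
  -- most 2 and the weaker bound `lt_card` suffices.
  · obtain ⟨F, hF, hσF⟩ := hσ.exists_isFacet
    have hFσ : (Δ.link σ).IsFace (F \ σ) := by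
      rw [isFace_link_iff hσ, Finset.sdiff_union_of_subset hσF]
      exact ⟨Finset.sdiff_disjoint, hF.1⟩
    have h2 := Finset.card_lt_card ((hlink _).mp hFσ)
    rw [Finset.card_sdiff_of_subset hσF, h F hF] at h2
    rcases Nat.eq_zero_or_pos m with rfl | hm
    · omega
    · have := hy.lt_card hm
      omega

/-- In a minimal cycle, the top-dimensional cycles are the multiples of one cycle with full
support. -/
theorem IsMinimalCycle.exists_generator (hΔ : Δ.IsMinimalCycle R d) :
    ∃ ζ : Finset V → R, Δ.IsChainOn Finset.univ d ζ ∧ boundary R ζ = 0 ∧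
      (∀ F, Δ.IsFacet F → ζ F ≠ 0) ∧
      ∀ y, Δ.IsChainOn Finset.univ d y → boundary R y = 0 → ∃ r : R, y = r • ζ := by
  obtain ⟨hpure, ⟨ζ, hζ⟩, hsupp, hspan⟩ := hΔ
  refine ⟨ζ, fun s hs => ⟨(hζ.1 s hs).1, (hζ.1 s hs).2, Finset.subset_univ s⟩, hζ.2, hsupp, ?_⟩
  intro y hy hby
  have hycyc : y ∈ Δ.cycles R d := ⟨fun s hs => ⟨(hy s hs).1, (hy s hs).2.1⟩, hby⟩
  have hmem : (Submodule.Quotient.mk ⟨y, hycyc⟩ : Δ.reducedHomology R d) ∈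
      Submodule.span R {(Submodule.Quotient.mk ⟨ζ, hζ⟩ : Δ.reducedHomology R d)} :=
    hspan ▸ Submodule.mem_top
  obtain ⟨r, hr⟩ := Submodule.mem_span_singleton.mp hmem
  refine ⟨r, ?_⟩
  rw [← Submodule.Quotient.mk_smul, Submodule.Quotient.eq] at hr
  obtain ⟨c, hc, hcr⟩ := hr
  -- Purity excludes faces of cardinality `d + 1`, so top homology classes are just cycles.
  have hc0 : c = 0 := by
    funext s
    by_contra hs
    have h1 := hc s hs
    have h2 := card_le_of_pure hpure h1.1
    omega
  rw [hc0, map_zero] at hcr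
  exact (sub_eq_zero.mp hcr.symm).symm

theorem IsMinimalCycle.le_card_vertex (hΔ : Δ.IsMinimalCycle R d) :
    2 * d - Δ.bannerNumber - 2 ≤ Nat.card Δ.Vertex := by
  classical
  obtain ⟨ζ, hζ, hbζ, hsupp, -⟩ := hΔ.exists_generator
  obtain ⟨F, hF, -⟩ := (show Δ.IsFace ∅ from Or.inl rfl).exists_isFacet
  have hess : Δ.IsEssentialCycleOn (Finset.univ.filter fun v => {v} ∈ Δ.faces) d ζ := by
    refine ⟨fun s hs => ⟨(hζ s hs).1, (hζ s hs).2.1, fun v hv => ?_⟩, hbζ, fun c hc hcζ => ?_⟩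
    · exact Finset.mem_filter.mpr ⟨Finset.mem_univ v,
        ((hζ s hs).1.mono (Finset.singleton_subset_iff.mpr hv)).mem_faces
          (Finset.singleton_nonempty v)⟩
    · have hc0 : c = 0 := by
        funext s
        by_contra hs
        have h1 := hc s hs
        have h2 := card_le_of_pure hΔ.1 h1.1
        omega
      rw [hc0, map_zero] at hcζ
      exact hsupp F hF (congrFun hcζ F).symm
  have := hess.two_mul_sub_bannerNumber_le_card hΔ.1 (by omega)
  rwa [Nat.card_eq_fintype_card, Fintype.card_subtype]

/-- A set `S` separating `A` from the other vertices carries an essential cycle of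
codimension one. -/
theorem IsMinimalCycle.exists_essentialCycleOn [IsDomain R] (hΔ : Δ.IsMinimalCycle R d)
    (hd : 0 < d) {A S : Finset V} {x y : V} (hx : {x} ∈ Δ.faces) (hy : {y} ∈ Δ.faces)
    (hxS : x ∉ S) (hyS : y ∉ S) (hxA : x ∈ A) (hyA : y ∉ A)
    (hA : ∀ u ∈ A, ∀ v, v ∉ A → v ∉ S → ({u, v} : Finset V) ∉ Δ.faces) :
    ∃ z : Finset V → R, Δ.IsEssentialCycleOn S (d - 1) z := by
  classical
  obtain ⟨ζ, hζ, hbζ, hsupp, hgen⟩ := hΔ.exists_generator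
  let ζA : Finset V → R := fun s => if Disjoint s A then 0 else ζ s
  have hζA : ∀ s, ζA s ≠ 0 → ζ s ≠ 0 ∧ ¬Disjoint s A := fun s hs => by
    by_cases h : Disjoint s A
    · exact absurd (if_pos h) hs
    · exact ⟨fun h0 => hs (by simp [ζA, h0]), h⟩
  have hchain : Δ.IsChainOn Finset.univ d ζA := fun s hs => hζ s (hζA s hs).1
  have hface : ∀ s, Δ.IsFace s → ¬Disjoint s A → s ⊆ A ∪ S := by
    intro s hs hsA v hv
    by_contra hvn
    rw [Finset.mem_union, not_or] at hvn
    obtain ⟨u, hus, huA⟩ := Finset.not_disjoint_iff.mp hsA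
    refine hA u huA v hvn.1 hvn.2 ((hs.mono ?_).mem_faces (Finset.insert_nonempty u _))
    simp [Finset.insert_subset_iff, hus, hv]
  refine ⟨boundary R ζA, ⟨fun t ht => ?_, boundary_boundary ζA, fun c hc hcζ => ?_⟩⟩
  · obtain ⟨v, hv, hne⟩ := Finset.exists_ne_zero_of_sum_ne_zero (boundary_apply ζA t ▸ ht)
    obtain ⟨hζv, hdis⟩ := hζA _ (right_ne_zero_of_mul hne)
    obtain ⟨h1, h2, -⟩ := hζ _ hζv
    rw [Finset.card_insert_of_notMem (Finset.mem_compl.mp hv)] at h2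
    refine ⟨h1.mono (Finset.subset_insert v t), by omega, fun u hu => ?_⟩
    -- At a face meeting `A`, every coface meets `A` too, so the boundaries of `ζA` and `ζ` agree
    -- there and vanish.
    have htA : Disjoint t A := by
      by_contra htA
      refine ht (Eq.trans ?_ (congrFun hbζ t))
      rw [boundary_apply, boundary_apply]
      refine Finset.sum_congr rfl fun w _ => ?_
      have : ¬Disjoint (insert w t) A := fun h =>
        htA (Finset.disjoint_of_subset_left (Finset.subset_insert w t) h)
      simp [ζA, this]
    exact (Finset.mem_union.mp (hface _ h1 hdis (Finset.mem_insert_of_mem hu))).resolve_left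
      (Finset.disjoint_left.mp htA hu)
  · rw [Nat.sub_add_cancel hd] at hc
    obtain ⟨r, hr⟩ := hgen (ζA - c) (hchain.sub (hc.mono (Finset.subset_univ S)))
      (by rw [map_sub, hcζ, sub_self])
    have hvanish : ∀ F : Finset V, ∀ v ∈ F, v ∉ S → c F = 0 := fun F v hvF hvS => by
      by_contra hne
      exact hvS ((hc F hne).2.2 hvF)
    obtain ⟨F, hF, hxF⟩ := IsFace.exists_isFacet (Or.inr hx)
    obtain ⟨G, hG, hyG⟩ := IsFace.exists_isFacet (Or.inr hy)
    rw [Finset.singleton_subset_iff] at hxF hyG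
    have hFA : ¬Disjoint F A := Finset.not_disjoint_iff.mpr ⟨x, hxF, hxA⟩
    have hGA : Disjoint G A := by
      by_contra hGA
      have := hface G hG.1 hGA hyG
      simp [hyA, hyS] at this
    have hrF := congrFun hr F
    have hrG := congrFun hr G
    simp only [Pi.sub_apply, Pi.smul_apply, smul_eq_mul, hvanish F x hxF hxS,
      hvanish G y hyG hyS, sub_zero, ζA, if_neg hFA, if_pos hGA] at hrF hrG
    -- On `G`, which contains `y`, both `ζA` and `c` vanish, which forces `r = 0` in a domain; on
    -- `F`, which contains `x`, the difference is `ζ F ≠ 0`.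
    have hr0 : r = 0 := (mul_eq_zero.mp hrG.symm).resolve_right (hsupp G hG)
    rw [hr0, zero_mul] at hrF
    exact hsupp F hF hrF

end MinimalCycle

end PreAbstractSimplicialComplex

theorem mainTheorem1 {V : Type*} [Fintype V] [LinearOrder V] {R : Type*} [CommRing R] [IsDomain R]
    (Δ : PreAbstractSimplicialComplex V) (d : ℕ) (hΔ : Δ.IsMinimalCycle R d) :
    Δ.underlyingGraph.IsVertexConnected (2 * d - Δ.bannerNumber - 2) := by
  classical
  refine ⟨hΔ.le_card_vertex, fun S hS => ?_⟩
  obtain ⟨x₀, hx₀⟩ : ∃ x, x ∉ S := by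
    by_contra! h
    have h1 := hΔ.le_card_vertex
    rw [Nat.card_eq_fintype_card, ← Finset.card_univ,
      ← Finset.eq_univ_iff_forall.mpr h] at h1
    omega
  have : Nonempty ↥((S : Set Δ.Vertex)ᶜ) := ⟨⟨x₀, by simpa using hx₀⟩⟩
  refine SimpleGraph.Connected.mk fun x y => ?_
  by_contra hxy
  let H := Δ.underlyingGraph.induce ((S : Set Δ.Vertex)ᶜ)
  -- `A` is the component of `x` after deleting `S`, viewed in `V`.
  let A : Finset V := Finset.univ.filter fun v => ∃ w, H.Reachable x w ∧ w.1.1 = v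
  have hmem : ∀ w : ↥((S : Set Δ.Vertex)ᶜ), w.1.1 ∈ A → H.Reachable x w := by
    intro w hw
    obtain ⟨w', hw', heq⟩ := (Finset.mem_filter.mp hw).2
    rwa [← Subtype.ext (Subtype.ext heq)]
  have hcompl : ∀ w : ↥((S : Set Δ.Vertex)ᶜ), w.1.1 ∉ S.map (Function.Embedding.subtype _) := by
    intro w hw
    obtain ⟨w', hw', heq⟩ := Finset.mem_map.mp hw
    exact w.2 (Subtype.ext heq ▸ hw')
  obtain ⟨z, hz⟩ := hΔ.exists_essentialCycleOn (A := A)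
    (S := S.map (Function.Embedding.subtype _)) (by omega) x.1.2 y.1.2 (hcompl x) (hcompl y)
    (Finset.mem_filter.mpr ⟨Finset.mem_univ _, x, SimpleGraph.Reachable.refl x, rfl⟩)
    (fun h => hxy (hmem y h)) (by
      intro u hu v hvA hvS huv
      obtain ⟨w, hw, rfl⟩ := (Finset.mem_filter.mp hu).2
      have hv : {v} ∈ Δ.faces :=
        (Δ.isRelLowerSet_faces huv).2 (by simp) (Finset.singleton_nonempty v)
      have hvS' : (⟨v, hv⟩ : Δ.Vertex) ∉ S := fun h =>
        hvS (Finset.mem_map.mpr ⟨⟨v, hv⟩, h, rfl⟩)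
      refine hvA (Finset.mem_filter.mpr ⟨Finset.mem_univ v, ⟨⟨v, hv⟩, by simpa using hvS'⟩,
        hw.trans (SimpleGraph.Adj.reachable ?_), rfl⟩)
      refine ⟨fun h => hvA ?_, huv⟩
      rw [show v = w.1.1 from (congrArg Subtype.val h).symm]
      exact hu)
  have := hz.two_mul_sub_bannerNumber_le_card hΔ.1 (by omega)
  rw [Finset.card_map] at this
  omega
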